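/- Let $n\ge 1$, $p\ge 2$, $1\le s\le p/2$ be integers and $\sigma>0$. For a matrix $\mathbb X\in\mathbb R^{n\times p}$ and $\beta\in\mathbb R^p$ let $\mathbb P_{\beta}$ be the law of $\mathbf y=\mathbb X\beta+\xi$ with $\xi\sim\mathcal N(0,\sigma^2 I_{n})$, and let $\mathbb E_\beta$ be the expectation under $\mathbb P_\beta$. Write $B_0(s)$ for the set of $\beta\in\mathbb R^p$ with at most $s$ nonzero coordinates, $|\cdot|_q$ for the $\ell_q$-norm on $\mathbb R^p$, $\|u\|_n^2=\frac1n\sum_{i=1}^n u_i^2$ for $u\in\mathbb R^n$, and, for an integer $1\le k\le p$, $$\bar\theta_{\min}(\mathbb X,k)=\min_{\delta\in B_0(k)\setminus\{0\}}\frac{\|\mathbb X\delta\|_n}{|\delta|_2},\qquad \bar\theta_{\max}(\mathbb X,k)=\max_{\delta\in B_0(k)\setminus\{0\}}\frac{\|\mathbb X\delta\|_n}{|\delta|_2}.$$ For $1\le q\le\infty$ put $\psi_{n,q}=\sigma s^{1/q}\sqrt{\log(ep/s)/n}$, with $s^{1/\infty}=1$. Let $\ell:[0,\infty)\to[0,\infty)$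 be nondecreasing with $\ell(0)=0$ and $\ell\not\equiv0$. Below, $\inf_{\hat\tau}$ is the infimum over all estimators of $\beta^*$, that is, all measurable functions of $\mathbf y$ with values in $\mathbb R^p$, which may also depend on the known matrix $\mathbb X$. (i) For every $1\le q\le\infty$ there exist constants $\bar b,\bar c>0$ depending only on $\ell$ and $q$ such that, for all $n,p,s,\sigma$ as above, $$\inf_{\hat\tau}\ \inf_{\mathbb X\in\mathbb R^{n\times p},\ \mathbb X\neq0}\ \sup_{\beta^*\in B_0(s)}\mathbb E_{\beta^*}\,\ell\Big(\bar b\,\psi_{n,q}^{-1}\,\bar\theta_{\max}(\mathbb X,1)\,|\hat\tau-\beta^*|_q\Big)\ \ge\ \bar c .$$ (ii) There exist constants $\bar b,\bar c>0$ depending only on $\ell$ such that, for all $n,p,s,\sigma$ as above, $$\inf_{\hat\tau}\ \inf_{\mathbb X\in\mathbb R^{n\times p}}\ \sup_{\beta^*\in B_0(s)}\mathbb E_{\beta^*}\,\ell\Big(\bar b\,\psi_{n,2}^{-1}\,\frac{\bar\theta_{\max}(\mathbb X,2s)}{\bar\theta_{\min}(\mathbb X,2s)}\,\|\mathbb X(\hat\tau-\beta^*)\|_n\Big)\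 \ge\ \bar c ,$$ where the expression under the expectation is $+\infty$, by definition, if $\bar\theta_{\min}(\mathbb X,2s)=0$. -/

import Mathlib

open MeasureTheory ProbabilityTheory
open scoped ENNReal NNReal Matrix

noncomputable section

/-- The class `B₀(s)` of `s`-sparse vectors: at most `s` nonzero coordinates. -/
def sparseBall (p s : ℕ) : Set (Fin p → ℝ) :=
  {β | (Finset.univ.filter fun j => β j ≠ 0).card ≤ s}

/-- The `ℓ_q` norm on `ℝ^p`, for `1 ≤ q ≤ ∞`. -/
def lqNorm {p : ℕ} (q : ℝ≥0∞) (v : Fin p → ℝ) : ℝ :=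
  ‖(WithLp.toLp q v : PiLp q fun _ : Fin p => ℝ)‖

/-- The empirical norm on `ℝ^n`: `‖u‖_n² = (1/n) ∑ u_i²`. -/
def empNorm {n : ℕ} (u : Fin n → ℝ) : ℝ :=
  Real.sqrt ((1 / (n : ℝ)) * ∑ i, u i ^ 2)

/-- The quotients `‖Xδ‖_n / |δ|₂` over nonzero `s`-sparse vectors `δ`. -/
def sparseRatios {n p : ℕ} (X : Matrix (Fin n) (Fin p) ℝ) (s : ℕ) : Set ℝ :=
  {r | ∃ δ ∈ sparseBall p s, δ ≠ 0 ∧ r = empNorm (X *ᵥ δ) / lqNorm 2 δ}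

/-- Minimal `s`-sparse eigenvalue; for `1 ≤ s` and `1 ≤ p` the infimum is a minimum, by
homogeneity and compactness. -/
def sparseEigMin {n p : ℕ} (X : Matrix (Fin n) (Fin p) ℝ) (s : ℕ) : ℝ :=
  sInf (sparseRatios X s)

/-- Maximal `s`-sparse eigenvalue; for `1 ≤ s` and `1 ≤ p` the supremum is a maximum, by
homogeneity and compactness. -/
def sparseEigMax {n p : ℕ} (X : Matrix (Fin n) (Fin p) ℝ) (s : ℕ) : ℝ :=
  sSup (sparseRatios X s)

/-- The rate `ψ_{n,q} = σ s^{1/q} √(log(ep/s)/n)`, where `s^{1/∞} = 1`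
(`1 / ∞ = 0` in `ℝ≥0∞`). -/
def minimaxRate (σ : ℝ) (n p s : ℕ) (q : ℝ≥0∞) : ℝ :=
  σ * (s : ℝ) ^ (1 / q).toReal * Real.sqrt (Real.log (Real.exp 1 * p / s) / n)

/-- The law `P_β` of the observation `y = Xβ + ξ` with `ξ ∼ N(0, σ² I_n)`. -/
def obsLaw {n p : ℕ} (X : Matrix (Fin n) (Fin p) ℝ) (σ : ℝ) (β : Fin p → ℝ) :
    Measure (EuclideanSpace ℝ (Fin n)) :=
  multivariateGaussian (WithLp.toLp 2 (X *ᵥ β)) (σ ^ 2 • (1 : Matrix (Fin n) (Fin n) ℝ))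

/-- Estimators of `β*`: measurable functions of the observation. The design is known, so an
estimator may depend on it in an arbitrary way. -/
def Estimator (n p : ℕ) : Type :=
  {τ : Matrix (Fin n) (Fin p) ℝ → EuclideanSpace ℝ (Fin n) → (Fin p → ℝ) //
    ∀ X, Measurable (τ X)}

/-- `E_β ℓ(b ψ_{n,q}⁻¹ θ_max(X,1) |τ - β|_q)`. -/
def estimationRisk (ℓ : ℝ≥0 → ℝ≥0) (b σ : ℝ) {n p : ℕ} (s : ℕ) (q : ℝ≥0∞)
    (τ : Estimator n p) (X : Matrix (Fin n) (Fin p) ℝ) (β : Fin p → ℝ) : ℝ≥0∞ :=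
  ∫⁻ y, (ℓ (b * (minimaxRate σ n p s q)⁻¹ * sparseEigMax X 1
      * lqNorm q (τ.1 X y - β)).toNNReal : ℝ≥0∞) ∂(obsLaw X σ β)

open scoped Classical in
/-- `E_β ℓ(b ψ_{n,2}⁻¹ (θ_max(X,2s) / θ_min(X,2s)) ‖X(τ - β)‖_n)`, the integrand being `+∞`
when `θ_min(X,2s) = 0`. -/
def predictionRisk (ℓ : ℝ≥0 → ℝ≥0) (b σ : ℝ) {n p : ℕ} (s : ℕ)
    (τ : Estimator n p) (X : Matrix (Fin n) (Fin p) ℝ) (β : Fin p → ℝ) : ℝ≥0∞ :=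
  ∫⁻ y, (if sparseEigMin X (2 * s) = 0 then ∞ else
    (ℓ (b * (minimaxRate σ n p s 2)⁻¹ * (sparseEigMax X (2 * s) / sparseEigMin X (2 * s))
      * empNorm (X *ᵥ (τ.1 X y - β))).toNNReal : ℝ≥0∞)) ∂(obsLaw X σ β)

end

/-!
Both bounds follow from the impossibility of identifying the support of a sparse vector. Split
`s * m` of the `p` coordinates, `m = ⌊p/s⌋ ≥ 2`, into `s` blocks of size `m`, and let a word
`f ∈ [m]^s` select one coordinate per block. The vector `β f` has the value `± r` at the selected
coordinates, with signs chosen so that `|X β f|² ≤ r² ∑ |X_j|²`, the sum being over the selected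
columns (`exists_signs_norm_sq_sum_le`, `exists_sparse_family`).

If `f` and `g` have Hamming distance more than `s / 8`, then `β f - β g` has more than `s / 8`
coordinates of size at least `r`, so an estimate with small loss determines `f` up to Hamming
distance `s / 8`. A Hamming ball of this radius contains at most a fraction `m ^ (-s / 8)` of all
words (`card_hammingBall_le`), which therefore bounds the average probability of success when the
data do not depend on the word, say under `P_0`. The likelihood ratio of `P_{β f}` with respect to
`P_0` has second moment `exp (|X β f|² / σ²)` (`lintegral_gaussianLikelihoodRatio_sq`). For
`r = σ √(log(ep/s)/n) / (8 θ)`, where `θ` bounds the empirical norms of the columns, it is at most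
`m ^ (s / 16)`, because `log(ep/s) ≤ 4 log m`. Hence under `P_{β f}` the average probability of
success is at most `m ^ (-s / 32) ≤ 2 ^ (-1 / 32) < 1` (`exists_measureReal_le_of_hamming`). No
restriction relating `n` to `s log(ep/s)` is needed, and the case of few hypotheses is not special.

For the estimation bound `θ = θ_max(X, 1)` and the loss is the `ℓ_q` norm. For the prediction bound
`θ = θ_max(X, 2s)`, and the loss is bounded below by `θ_min(X, 2s)` times the `ℓ_2` norm on the
`2s`-sparse differences (`exists_obsLaw_real_ge` treats both). Markov's inequality passes from
probabilities to `ℓ`.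
-/

/-! ### Shifts of Gaussian measures -/

/-- The likelihood ratio of `N(h, I)` with respect to `N(0, I)`. -/
noncomputable def gaussianLikelihoodRatio {ι : Type*} [Fintype ι] (h x : ι → ℝ) : ℝ≥0∞ :=
  ∏ i, ENNReal.ofReal (Real.exp (h i * x i - h i ^ 2 / 2))

lemma measurable_gaussianLikelihoodRatio {ι : Type*} [Fintype ι] (h : ι → ℝ) :
    Measurable (gaussianLikelihoodRatio h) := by
  unfold gaussianLikelihoodRatio
  fun_prop

lemma gaussianReal_eq_withDensity_std (m : ℝ) :
    gaussianReal m 1 = (gaussianReal 0 1).withDensity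
      (fun x => ENNReal.ofReal (Real.exp (m * x - m ^ 2 / 2))) := by
  rw [gaussianReal_of_var_ne_zero m one_ne_zero, gaussianReal_of_var_ne_zero 0 one_ne_zero,
    ← withDensity_mul _ (measurable_gaussianPDF 0 1) (by fun_prop)]
  congr 1
  funext x
  rw [Pi.mul_apply, gaussianPDF, gaussianPDF, ← ENNReal.ofReal_mul (gaussianPDFReal_nonneg _ _ _),
    gaussianPDFReal, gaussianPDFReal, mul_assoc _ (Real.exp _) (Real.exp _), ← Real.exp_add]
  congr 3
  simp only [NNReal.coe_one]
  ring

lemma pi_gaussianReal_eq_withDensity {ι : Type*} [Fintype ι] (h : ι → ℝ) :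
    Measure.pi (fun i => gaussianReal (h i) 1) =
      (Measure.pi fun _ : ι => gaussianReal 0 1).withDensity (gaussianLikelihoodRatio h) := by
  refine Measure.pi_eq fun S hS => ?_
  have hind : iIndepFun (fun (i : ι) (x : ι → ℝ) => (S i).indicator
      (fun u => ENNReal.ofReal (Real.exp (h i * u - h i ^ 2 / 2))) (x i))
      (Measure.pi fun _ : ι => gaussianReal 0 1) :=
    iIndepFun_pi (X := fun i u => (S i).indicator
      (fun u => ENNReal.ofReal (Real.exp (h i * u - h i ^ 2 / 2))) u)
      fun i => (Measurable.indicator (by fun_prop) (hS i)).aemeasurable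
  rw [withDensity_apply _ (MeasurableSet.univ_pi hS),
    ← lintegral_indicator (MeasurableSet.univ_pi hS)]
  have hprod : ∀ x : ι → ℝ, (Set.univ.pi S).indicator (gaussianLikelihoodRatio h) x =
      ∏ i, (S i).indicator
        (fun u => ENNReal.ofReal (Real.exp (h i * u - h i ^ 2 / 2))) (x i) := by
    intro x
    by_cases hx : x ∈ Set.univ.pi S
    · rw [Set.indicator_of_mem hx]
      exact Finset.prod_congr rfl fun i _ =>
        (Set.indicator_of_mem (hx i trivial)
          fun u => ENNReal.ofReal (Real.exp (h i * u - h i ^ 2 / 2))).symm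
    · rw [Set.indicator_of_notMem hx]
      simp only [Set.mem_pi, Set.mem_univ, true_implies, not_forall] at hx
      obtain ⟨i, hi⟩ := hx
      exact (Finset.prod_eq_zero (Finset.mem_univ i) (Set.indicator_of_notMem hi _)).symm
  simp_rw [hprod]
  rw [lintegral_prod_eq_prod_lintegral_of_indepFun Finset.univ _ hind
    fun i => (Measurable.indicator (by fun_prop) (hS i)).comp (measurable_pi_apply i)]
  refine Finset.prod_congr rfl fun i _ => ?_
  rw [gaussianReal_eq_withDensity_std (h i), withDensity_apply _ (hS i),
    ← lintegral_indicator (hS i)]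
  exact (measurePreserving_eval (fun _ : ι => gaussianReal 0 1) i).lintegral_comp
    (f := (S i).indicator fun u => ENNReal.ofReal (Real.exp (h i * u - h i ^ 2 / 2)))
    (Measurable.indicator (by fun_prop) (hS i))

/-- The second moment of the likelihood ratio: its square is a constant multiple of the
likelihood ratio of the doubled shift, which has mean one. -/
lemma lintegral_gaussianLikelihoodRatio_sq {ι : Type*} [Fintype ι] (h : ι → ℝ) :
    ∫⁻ x, gaussianLikelihoodRatio h x ^ 2 ∂(Measure.pi fun _ : ι => gaussianReal 0 1) =
      ENNReal.ofReal (Real.exp (∑ i, h i ^ 2)) := by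
  have hsq : ∀ x, gaussianLikelihoodRatio h x ^ 2 =
      ENNReal.ofReal (Real.exp (∑ i, h i ^ 2)) * gaussianLikelihoodRatio (2 • h) x := by
    intro x
    rw [gaussianLikelihoodRatio, gaussianLikelihoodRatio, Real.exp_sum,
      ENNReal.ofReal_prod_of_nonneg fun _ _ => (Real.exp_pos _).le, ← Finset.prod_mul_distrib,
      ← Finset.prod_pow]
    refine Finset.prod_congr rfl fun i _ => ?_
    rw [← ENNReal.ofReal_pow (Real.exp_pos _).le, ← ENNReal.ofReal_mul (Real.exp_pos _).le,
      ← Real.exp_add, ← Real.exp_nat_mul]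
    congr 2
    simp
    ring
  simp_rw [hsq]
  rw [lintegral_const_mul _ (measurable_gaussianLikelihoodRatio _), ← setLIntegral_univ,
    ← withDensity_apply _ MeasurableSet.univ, ← pi_gaussianReal_eq_withDensity, measure_univ,
    mul_one]

/-- Change of measure between `N(h, I)` and `N(0, I)`: bound the likelihood ratio `L` on `A` by
`t/2 * L² + 1/(2t)`. -/
lemma pi_gaussianReal_apply_le {ι : Type*} [Fintype ι] (h : ι → ℝ) {A : Set (ι → ℝ)}
    (hA : MeasurableSet A) {t : ℝ} (ht : 0 < t) :
    Measure.pi (fun i => gaussianReal (h i) 1) A ≤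
      ENNReal.ofReal (t / 2 * Real.exp (∑ i, h i ^ 2)) +
        ENNReal.ofReal (1 / (2 * t)) * Measure.pi (fun _ : ι => gaussianReal 0 1) A := by
  have hamgm : ∀ x, gaussianLikelihoodRatio h x ≤
      ENNReal.ofReal (t / 2) * gaussianLikelihoodRatio h x ^ 2 + ENNReal.ofReal (1 / (2 * t)) := by
    intro x
    rw [gaussianLikelihoodRatio, ← ENNReal.ofReal_prod_of_nonneg fun _ _ => (Real.exp_pos _).le]
    set L := ∏ i, Real.exp (h i * x i - h i ^ 2 / 2)
    have hL : 0 ≤ L := Finset.prod_nonneg fun _ _ => (Real.exp_pos _).le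
    rw [← ENNReal.ofReal_pow hL, ← ENNReal.ofReal_mul (by positivity),
      ← ENNReal.ofReal_add (by positivity) (by positivity)]
    refine ENNReal.ofReal_le_ofReal ?_
    have hsq : t / 2 * L ^ 2 + 1 / (2 * t) - L = (t * L - 1) ^ 2 / (2 * t) := by
      field_simp
      ring
    have := div_nonneg (sq_nonneg (t * L - 1)) (by positivity : 0 ≤ 2 * t)
    linarith
  rw [pi_gaussianReal_eq_withDensity, withDensity_apply _ hA]
  calc ∫⁻ x in A, gaussianLikelihoodRatio h x ∂(Measure.pi fun _ : ι => gaussianReal 0 1)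
      ≤ ∫⁻ x in A, (ENNReal.ofReal (t / 2) * gaussianLikelihoodRatio h x ^ 2 +
          ENNReal.ofReal (1 / (2 * t))) ∂(Measure.pi fun _ : ι => gaussianReal 0 1) :=
        lintegral_mono hamgm
    _ = ENNReal.ofReal (t / 2) * (∫⁻ x in A, gaussianLikelihoodRatio h x ^ 2
            ∂(Measure.pi fun _ : ι => gaussianReal 0 1)) +
          ENNReal.ofReal (1 / (2 * t)) * Measure.pi (fun _ : ι => gaussianReal 0 1) A := by
        rw [lintegral_add_right _ measurable_const, setLIntegral_const,
          lintegral_const_mul _ ((measurable_gaussianLikelihoodRatio h).pow_const 2)]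
    _ ≤ _ := by
        gcongr
        rw [ENNReal.ofReal_mul (by positivity), ← lintegral_gaussianLikelihoodRatio_sq]
        exact mul_le_mul_right (setLIntegral_le_lintegral _ _) _

open scoped MatrixOrder in
lemma cfc_sqrt_sq_smul_one {n : ℕ} {σ : ℝ} (hσ : 0 < σ) :
    CFC.sqrt (σ ^ 2 • (1 : Matrix (Fin n) (Fin n) ℝ)) = σ • (1 : Matrix (Fin n) (Fin n) ℝ) := by
  refine CFC.sqrt_unique ?_ ?_
  · rw [smul_mul_smul_comm, mul_one, sq]
  · exact (Matrix.PosSemidef.one.smul hσ.le).nonneg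

/-- After division by `σ`, the observation is a product of unit-variance Gaussians. -/
lemma obsLaw_apply {n p : ℕ} (X : Matrix (Fin n) (Fin p) ℝ) {σ : ℝ} (hσ : 0 < σ)
    (β : Fin p → ℝ) {A : Set (EuclideanSpace ℝ (Fin n))} (hA : MeasurableSet A) :
    obsLaw X σ β A = Measure.pi (fun i => gaussianReal ((X *ᵥ β) i / σ) 1)
      {x | σ • WithLp.toLp 2 x ∈ A} := by
  have hshift : Measure.pi (fun i => gaussianReal ((X *ᵥ β) i / σ) 1) =
      (Measure.pi fun _ : Fin n => gaussianReal 0 1).map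
        (fun x i => (X *ᵥ β) i / σ + x i) := by
    rw [Measure.pi_map_pi (f := fun i u => (X *ᵥ β) i / σ + u) fun i => by fun_prop]
    congr 1
    funext i
    rw [gaussianReal_map_const_add, zero_add]
  have hB : MeasurableSet {x : Fin n → ℝ | σ • WithLp.toLp 2 x ∈ A} :=
    hA.preimage (f := fun x : Fin n → ℝ => σ • WithLp.toLp 2 x) (by fun_prop)
  rw [obsLaw, multivariateGaussian, cfc_sqrt_sq_smul_one hσ, ← map_pi_eq_stdGaussian,
    Measure.map_map (by fun_prop) (by fun_prop), Measure.map_apply (by fun_prop) hA, hshift,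
    Measure.map_apply (by fun_prop) hB]
  congr 1
  ext x
  simp only [Set.mem_preimage, Set.mem_ofPred_eq, Function.comp]
  have : WithLp.toLp 2 (X *ᵥ β) +
      (Matrix.toEuclideanCLM (𝕜 := ℝ) (σ • (1 : Matrix (Fin n) (Fin n) ℝ))) (WithLp.toLp 2 x) =
      σ • WithLp.toLp 2 (fun i => (X *ᵥ β) i / σ + x i) := by
    ext i
    simp
    field_simp
  rw [this]

instance {n p : ℕ} (X : Matrix (Fin n) (Fin p) ℝ) (σ : ℝ) (β : Fin p → ℝ) :
    IsProbabilityMeasure (obsLaw X σ β) := by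
  unfold obsLaw
  infer_instance

/-- Change of measure from `P_β` to `P_0`, with the weight `t` of the second moment free. -/
lemma obsLaw_real_le {n p : ℕ} (X : Matrix (Fin n) (Fin p) ℝ) {σ : ℝ} (hσ : 0 < σ)
    (β : Fin p → ℝ) {A : Set (EuclideanSpace ℝ (Fin n))} (hA : MeasurableSet A)
    {t : ℝ} (ht : 0 < t) :
    (obsLaw X σ β).real A ≤
      t / 2 * Real.exp (‖(WithLp.toLp 2 (X *ᵥ β) : EuclideanSpace ℝ (Fin n))‖ ^ 2 / σ ^ 2) +
        1 / (2 * t) * (obsLaw X σ 0).real A := by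
  have hB : MeasurableSet {x : Fin n → ℝ | σ • WithLp.toLp 2 x ∈ A} :=
    hA.preimage (f := fun x : Fin n → ℝ => σ • WithLp.toLp 2 x) (by fun_prop)
  have h := pi_gaussianReal_apply_le (fun i => (X *ᵥ β) i / σ) hB ht
  have h0 := obsLaw_apply X hσ 0 hA
  simp only [Matrix.mulVec_zero, Pi.zero_apply, zero_div] at h0
  rw [← obsLaw_apply X hσ β hA, ← h0] at h
  have h' := ENNReal.toReal_mono (by finiteness) h
  rw [ENNReal.toReal_add (by finiteness) (by finiteness), ENNReal.toReal_mul,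
    ENNReal.toReal_ofReal (by positivity), ENNReal.toReal_ofReal (by positivity)] at h'
  rw [EuclideanSpace.real_norm_sq_eq, Finset.sum_div]
  simpa only [measureReal_def, div_pow] using h'

/-! ### Hamming balls and overlapping events -/

/-- For `m ≥ 3` the left side is less than `2 = 16 ^ (1/4)` and `16 ≤ 27 ≤ m ^ 3`; the case `m = 2`
is `81 / 16 ≤ 8`. -/
lemma two_sub_inv_le_rpow {m : ℕ} (hm : 2 ≤ m) : 2 - (m : ℝ)⁻¹ ≤ (m : ℝ) ^ (3 / 4 : ℝ) := by
  obtain rfl | hm3 := hm.eq_or_lt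
  · have h : (3 / 2 : ℝ) = ((3 / 2 : ℝ) ^ (4 : ℝ)) ^ (1 / 4 : ℝ) := by
      rw [← Real.rpow_mul (by norm_num)]
      norm_num
    have h' : ((2 : ℕ) : ℝ) ^ (3 / 4 : ℝ) = ((2 : ℝ) ^ (3 : ℝ)) ^ (1 / 4 : ℝ) := by
      rw [← Real.rpow_mul (by norm_num)]
      norm_num
    rw [h', show (2 - ((2 : ℕ) : ℝ)⁻¹ : ℝ) = 3 / 2 by norm_num, h]
    refine Real.rpow_le_rpow (by positivity) ?_ (by norm_num)
    norm_num
  · have h' : (m : ℝ) ^ (3 / 4 : ℝ) = ((m : ℝ) ^ (3 : ℝ)) ^ (1 / 4 : ℝ) := by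
      rw [← Real.rpow_mul (by positivity)]
      norm_num
    have h : (2 : ℝ) = ((2 : ℝ) ^ (4 : ℝ)) ^ (1 / 4 : ℝ) := by
      rw [← Real.rpow_mul (by norm_num)]
      norm_num
    have hm3' : (3 : ℝ) ≤ m := by exact_mod_cast hm3
    calc 2 - (m : ℝ)⁻¹ ≤ 2 := by linarith [inv_nonneg.2 (by linarith : (0 : ℝ) ≤ m)]
      _ = ((2 : ℝ) ^ (4 : ℝ)) ^ (1 / 4 : ℝ) := h
      _ ≤ ((m : ℝ) ^ (3 : ℝ)) ^ (1 / 4 : ℝ) := by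
        refine Real.rpow_le_rpow (by positivity) ?_ (by norm_num)
        calc (2 : ℝ) ^ (4 : ℝ) ≤ 3 ^ (3 : ℝ) := by norm_num
          _ ≤ (m : ℝ) ^ (3 : ℝ) := Real.rpow_le_rpow (by norm_num) hm3' (by norm_num)
      _ = _ := h'.symm

/-- The generating function of the Hamming distance to a fixed word. -/
lemma sum_pow_hammingDist {s m : ℕ} (f₀ : Fin s → Fin m) (t : ℝ) :
    ∑ f : Fin s → Fin m, t ^ hammingDist f f₀ = (1 + (m - 1) * t) ^ s := by
  have hpow : ∀ f : Fin s → Fin m,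
      t ^ hammingDist f f₀ = ∏ k, if f k ≠ f₀ k then t else 1 := by
    intro f
    rw [hammingDist, ← Finset.prod_filter, Finset.prod_const]
  simp_rw [hpow]
  rw [← Fintype.piFinset_univ, ← Finset.prod_univ_sum (fun _ => (Finset.univ : Finset (Fin m)))
    (fun k j => if j ≠ f₀ k then t else 1)]
  have hsum : ∀ k, ∑ j, (if j ≠ f₀ k then t else 1) = 1 + ((m : ℝ) - 1) * t := by
    intro k
    have hm : 1 ≤ m := (f₀ k).pos
    rw [← Finset.add_sum_erase _ _ (Finset.mem_univ (f₀ k)),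
      Finset.sum_congr rfl fun j hj => if_pos (Finset.ne_of_mem_erase hj)]
    simp [hm]
  rw [Finset.prod_congr rfl fun k _ => hsum k, Finset.prod_const, Finset.card_univ,
    Fintype.card_fin]

/-- A Chernoff bound: Hamming balls of radius `s / 8` in `[m]^s` have size at most
`m ^ (7 s / 8)`. -/
lemma card_hammingBall_le {s m : ℕ} (hm : 2 ≤ m) (f₀ : Fin s → Fin m) :
    ((Finset.univ.filter fun f : Fin s → Fin m => 8 * hammingDist f f₀ ≤ s).card : ℝ) ≤
      (m : ℝ) ^ (7 / 8 * s : ℝ) := by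
  set B := Finset.univ.filter fun f : Fin s → Fin m => 8 * hammingDist f f₀ ≤ s
  have hm0 : (0 : ℝ) < m := by positivity
  have hm1 : (1 : ℝ) ≤ m := by exact_mod_cast (by omega : 1 ≤ m)
  have hterm : ∀ f ∈ B, (m : ℝ) ^ (-(s / 8) : ℝ) ≤ ((m : ℝ)⁻¹) ^ hammingDist f f₀ := by
    intro f hf
    rw [inv_pow, ← Real.rpow_natCast, ← Real.rpow_neg hm0.le]
    refine Real.rpow_le_rpow_of_exponent_le hm1 ?_
    have : (8 * hammingDist f f₀ : ℝ) ≤ s := by exact_mod_cast (Finset.mem_filter.1 hf).2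
    linarith
  -- Markov's inequality for `t ^ d` with `t = 1 / m`, where `d` is the distance to `f₀`.
  have hsum : (B.card : ℝ) * (m : ℝ) ^ (-(s / 8) : ℝ) ≤ (m : ℝ) ^ (3 / 4 * s : ℝ) := by
    calc (B.card : ℝ) * (m : ℝ) ^ (-(s / 8) : ℝ)
        ≤ ∑ f ∈ B, ((m : ℝ)⁻¹) ^ hammingDist f f₀ := by
          rw [← nsmul_eq_mul]
          exact Finset.card_nsmul_le_sum _ _ _ hterm
      _ ≤ ∑ f : Fin s → Fin m, ((m : ℝ)⁻¹) ^ hammingDist f f₀ :=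
          Finset.sum_le_univ_sum_of_nonneg fun _ => by positivity
      _ = (2 - (m : ℝ)⁻¹) ^ s := by
          rw [sum_pow_hammingDist]
          congr 1
          field_simp
          ring
      _ ≤ ((m : ℝ) ^ (3 / 4 : ℝ)) ^ s := by
          refine pow_le_pow_left₀ ?_ (two_sub_inv_le_rpow hm) s
          linarith [inv_le_one_of_one_le₀ hm1]
      _ = (m : ℝ) ^ (3 / 4 * s : ℝ) := by rw [← Real.rpow_natCast, ← Real.rpow_mul hm0.le]
  calc (B.card : ℝ) = B.card * (m : ℝ) ^ (-(s / 8) : ℝ) * (m : ℝ) ^ (s / 8 : ℝ) := by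
        rw [mul_assoc, ← Real.rpow_add hm0, neg_add_cancel, Real.rpow_zero, mul_one]
    _ ≤ (m : ℝ) ^ (3 / 4 * s : ℝ) * (m : ℝ) ^ (s / 8 : ℝ) := by gcongr
    _ = (m : ℝ) ^ (7 / 8 * s : ℝ) := by
        rw [← Real.rpow_add hm0]
        congr 1
        ring

/-- If every point lies in at most `K` of the events, then their probabilities add up to at
most `K`. -/
lemma sum_measureReal_le_of_card_le {ι Ω : Type*} [Fintype ι] [MeasurableSpace Ω]
    (μ : Measure Ω) [IsProbabilityMeasure μ] {A : ι → Set Ω} (hA : ∀ i, MeasurableSet (A i))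
    {K : ℝ} (hK0 : 0 ≤ K)
    (hK : ∀ y i₀, y ∈ A i₀ → ∃ S : Finset ι, (∀ i, y ∈ A i → i ∈ S) ∧ (S.card : ℝ) ≤ K) :
    ∑ i, μ.real (A i) ≤ K := by
  classical
  have hint : ∀ i, Integrable ((A i).indicator (1 : Ω → ℝ)) μ := fun i =>
    (integrable_const (1 : ℝ)).indicator (hA i)
  have hsum : ∑ i, μ.real (A i) = ∫ y, ∑ i, (A i).indicator (1 : Ω → ℝ) y ∂μ := by
    rw [integral_finsetSum _ fun i _ => hint i]
    exact Finset.sum_congr rfl fun i _ => (integral_indicator_one (hA i)).symm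
  rw [hsum]
  have hbound : ∀ y, ∑ i, (A i).indicator (1 : Ω → ℝ) y ≤ K := by
    intro y
    by_cases hy : ∃ i₀, y ∈ A i₀
    · obtain ⟨i₀, hi₀⟩ := hy
      obtain ⟨S, hS, hSK⟩ := hK y i₀ hi₀
      refine le_trans ?_ hSK
      have : ∀ i, (A i).indicator (1 : Ω → ℝ) y ≤ if i ∈ S then 1 else 0 := by
        intro i
        by_cases hi : y ∈ A i
        · simp [hi, hS i hi]
        · rw [Set.indicator_of_notMem hi]
          positivity
      exact (Finset.sum_le_sum fun i _ => this i).trans (by simp)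
    · push Not at hy
      simpa [Set.indicator_of_notMem (hy _)] using hK0
  calc ∫ y, ∑ i, (A i).indicator (1 : Ω → ℝ) y ∂μ ≤ ∫ _, K ∂μ :=
        integral_mono (integrable_finsetSum _ fun i _ => hint i) (integrable_const K) hbound
    _ = K := by simp

/-- A Bayesian lower bound on the error probability of decoding a word of `[m]^s` up to Hamming
distance `s / 8`. The words are drawn uniformly; under the reference measure `P₀`, which does not
depend on the word, the events `A f` have average probability at most `m ^ (-s / 8)`, and the
change of measure with `t = m ^ (-3 s / 32)` loses at most a factor `m ^ (3 s / 32)`. -/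
lemma exists_measureReal_le_of_hamming {s m : ℕ} (hs : 1 ≤ s) (hm : 2 ≤ m)
    {Ω : Type*} [MeasurableSpace Ω] (P₀ : Measure Ω) [IsProbabilityMeasure P₀]
    (P : (Fin s → Fin m) → Measure Ω) {E : ℝ} (hE : E ≤ (m : ℝ) ^ (s / 16 : ℝ))
    (hP : ∀ f A, MeasurableSet A → ∀ t : ℝ, 0 < t →
      (P f).real A ≤ t / 2 * E + 1 / (2 * t) * P₀.real A)
    {A : (Fin s → Fin m) → Set Ω} (hA : ∀ f, MeasurableSet (A f))
    (hsep : ∀ y f g, y ∈ A f → y ∈ A g → 8 * hammingDist f g ≤ s) :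
    ∃ f, (P f).real (A f) ≤ (2 : ℝ) ^ (-(1 / 32) : ℝ) := by
  have hm0 : (0 : ℝ) < m := by positivity
  have : NeZero m := ⟨by omega⟩
  have hrpow : ∀ a b : ℝ, (m : ℝ) ^ a * (m : ℝ) ^ b = (m : ℝ) ^ (a + b) := fun a b =>
    (Real.rpow_add hm0 a b).symm
  set t : ℝ := (m : ℝ) ^ (-(3 / 32) * s : ℝ) with ht
  have ht0 : 0 < t := by positivity
  have hsum₀ : ∑ f, P₀.real (A f) ≤ (m : ℝ) ^ (7 / 8 * s : ℝ) := by
    refine sum_measureReal_le_of_card_le P₀ hA (by positivity) fun y g hg =>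
      ⟨Finset.univ.filter fun f : Fin s → Fin m => 8 * hammingDist f g ≤ s, fun f hf => ?_,
        card_hammingBall_le hm g⟩
    simpa using hsep y f g hf hg
  have hcard : ((Finset.univ : Finset (Fin s → Fin m)).card : ℝ) = (m : ℝ) ^ (s : ℝ) := by
    simp
  have hsum : ∑ f, (P f).real (A f) ≤
      ∑ _f : Fin s → Fin m, (m : ℝ) ^ (-(1 / 32) * s : ℝ) := by
    calc ∑ f, (P f).real (A f)
        ≤ ∑ f, (t / 2 * (m : ℝ) ^ (s / 16 : ℝ) + 1 / (2 * t) * P₀.real (A f)) :=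
          Finset.sum_le_sum fun f _ => (hP f _ (hA f) t ht0).trans (by gcongr)
      _ = (m : ℝ) ^ (s : ℝ) * (t / 2 * (m : ℝ) ^ (s / 16 : ℝ)) +
            1 / (2 * t) * ∑ f, P₀.real (A f) := by
          rw [Finset.sum_add_distrib, Finset.sum_const, nsmul_eq_mul, hcard, Finset.mul_sum]
      _ ≤ (m : ℝ) ^ (s : ℝ) * (t / 2 * (m : ℝ) ^ (s / 16 : ℝ)) +
            1 / (2 * t) * (m : ℝ) ^ (7 / 8 * s : ℝ) := by gcongr
      _ = 1 / 2 * ((m : ℝ) ^ (s : ℝ) * t * (m : ℝ) ^ (s / 16 : ℝ)) +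
            1 / 2 * (t⁻¹ * (m : ℝ) ^ (7 / 8 * s : ℝ)) := by
          field_simp
      _ = (m : ℝ) ^ (s : ℝ) * (m : ℝ) ^ (-(1 / 32) * s : ℝ) := by
          rw [ht, ← Real.rpow_neg hm0.le, hrpow, hrpow, hrpow, hrpow]
          ring_nf
      _ = _ := by rw [Finset.sum_const, nsmul_eq_mul, hcard]
  obtain ⟨f, -, hf⟩ := Finset.exists_le_of_sum_le Finset.univ_nonempty hsum
  refine ⟨f, hf.trans ?_⟩
  have hs1 : (1 : ℝ) ≤ s := by exact_mod_cast hs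
  have hm2 : (2 : ℝ) ≤ m := by exact_mod_cast hm
  calc (m : ℝ) ^ (-(1 / 32) * s : ℝ) ≤ (m : ℝ) ^ (-(1 / 32) : ℝ) :=
        Real.rpow_le_rpow_of_exponent_le (by linarith) (by linarith)
    _ ≤ (2 : ℝ) ^ (-(1 / 32) : ℝ) :=
        Real.rpow_le_rpow_of_nonpos (by norm_num) hm2 (by norm_num)

/-! ### Norms and sparse eigenvalues -/

lemma lqNorm_sub_le {p : ℕ} {q : ℝ≥0∞} (hq : 1 ≤ q) (u v : Fin p → ℝ) :
    lqNorm q (u - v) ≤ lqNorm q u + lqNorm q v := by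
  have : Fact (1 ≤ q) := ⟨hq⟩
  rw [lqNorm, WithLp.toLp_sub]
  exact norm_sub_le _ _

lemma measurable_lqNorm {p : ℕ} {q : ℝ≥0∞} (hq : 1 ≤ q) :
    Measurable (lqNorm q : (Fin p → ℝ) → ℝ) := by
  have : Fact (1 ≤ q) := ⟨hq⟩
  exact (continuous_norm.comp (PiLp.continuous_toLp q _)).measurable

lemma lqNorm_two_pos {p : ℕ} {v : Fin p → ℝ} (hv : v ≠ 0) : 0 < lqNorm 2 v :=
  norm_pos_iff.2 fun h => hv ((WithLp.toLp_eq_zero 2).1 h)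

lemma mul_card_rpow_le_lqNorm {p : ℕ} {q : ℝ≥0∞} (hq : 1 ≤ q) {v : Fin p → ℝ} {r : ℝ}
    (hr : 0 ≤ r) {T : Finset (Fin p)} (hT : T.Nonempty) (hv : ∀ j ∈ T, r ≤ |v j|) :
    r * (T.card : ℝ) ^ (1 / q).toReal ≤ lqNorm q v := by
  have : Fact (1 ≤ q) := ⟨hq⟩
  by_cases hq' : q = ∞
  · obtain ⟨j, hj⟩ := hT
    subst hq'
    have h := PiLp.norm_apply_le (WithLp.toLp ∞ v : PiLp ∞ fun _ : Fin p => ℝ) j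
    rw [ENNReal.div_top, ENNReal.toReal_zero, Real.rpow_zero, mul_one]
    exact (hv j hj).trans h
  · have hpos : 0 < q.toReal := ENNReal.toReal_pos (by positivity) hq'
    rw [lqNorm, PiLp.norm_eq_sum hpos]
    simp only [one_div, ENNReal.toReal_inv]
    calc r * (T.card : ℝ) ^ q.toReal⁻¹ = (∑ j ∈ T, r ^ q.toReal) ^ q.toReal⁻¹ := by
          rw [Finset.sum_const, nsmul_eq_mul, mul_comm (T.card : ℝ),
            Real.mul_rpow (by positivity) (by positivity), ← Real.rpow_mul hr,
            mul_inv_cancel₀ hpos.ne', Real.rpow_one]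
      _ ≤ _ := by
          refine Real.rpow_le_rpow (by positivity) ?_ (by positivity)
          calc ∑ j ∈ T, r ^ q.toReal ≤ ∑ j ∈ T, ‖v j‖ ^ q.toReal :=
                Finset.sum_le_sum fun j hj => Real.rpow_le_rpow hr (hv j hj) hpos.le
            _ ≤ ∑ j, ‖v j‖ ^ q.toReal :=
                Finset.sum_le_univ_sum_of_nonneg fun j => by positivity

lemma empNorm_eq {n : ℕ} (u : Fin n → ℝ) :
    empNorm u = ‖(WithLp.toLp 2 u : EuclideanSpace ℝ (Fin n))‖ / Real.sqrt n := by
  rw [empNorm, EuclideanSpace.norm_eq, ← Real.sqrt_div (by positivity)]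
  congr 1
  simp
  ring

lemma empNorm_nonneg {n : ℕ} (u : Fin n → ℝ) : 0 ≤ empNorm u := Real.sqrt_nonneg _

lemma empNorm_sub_le {n : ℕ} (u v : Fin n → ℝ) : empNorm (u - v) ≤ empNorm u + empNorm v := by
  simp only [empNorm_eq, ← add_div, WithLp.toLp_sub]
  gcongr
  exact norm_sub_le _ _

lemma bddAbove_sparseRatios {n p : ℕ} (X : Matrix (Fin n) (Fin p) ℝ) (k : ℕ) :
    BddAbove (sparseRatios X k) := by
  set L := LinearMap.toContinuousLinearMap (Matrix.toEuclideanLin X)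
  refine ⟨‖L‖ / Real.sqrt n, ?_⟩
  rintro _ ⟨δ, -, hδ, rfl⟩
  rw [div_le_iff₀ (lqNorm_two_pos hδ), empNorm_eq, div_mul_eq_mul_div]
  gcongr
  exact L.le_opNorm (WithLp.toLp 2 δ)

lemma empNorm_mulVec_le {n p : ℕ} (X : Matrix (Fin n) (Fin p) ℝ) {k : ℕ} {δ : Fin p → ℝ}
    (hδ : δ ∈ sparseBall p k) (hδ0 : δ ≠ 0) :
    empNorm (X *ᵥ δ) ≤ sparseEigMax X k * lqNorm 2 δ := by
  rw [← div_le_iff₀ (lqNorm_two_pos hδ0)]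
  exact le_csSup (bddAbove_sparseRatios X k) ⟨δ, hδ, hδ0, rfl⟩

lemma sparseEigMin_nonneg {n p : ℕ} (X : Matrix (Fin n) (Fin p) ℝ) (k : ℕ) :
    0 ≤ sparseEigMin X k := by
  refine Real.sInf_nonneg ?_
  rintro _ ⟨δ, -, -, rfl⟩
  exact div_nonneg (empNorm_nonneg _) (norm_nonneg _)

lemma sparseEigMin_mul_le {n p : ℕ} (X : Matrix (Fin n) (Fin p) ℝ) {k : ℕ} {δ : Fin p → ℝ}
    (hδ : δ ∈ sparseBall p k) (hδ0 : δ ≠ 0) :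
    sparseEigMin X k * lqNorm 2 δ ≤ empNorm (X *ᵥ δ) := by
  rw [← le_div_iff₀ (lqNorm_two_pos hδ0)]
  refine csInf_le ⟨0, ?_⟩ ⟨δ, hδ, hδ0, rfl⟩
  rintro _ ⟨δ, -, -, rfl⟩
  exact div_nonneg (empNorm_nonneg _) (norm_nonneg _)

lemma single_mem_sparseBall {p k : ℕ} (hk : 1 ≤ k) (j : Fin p) :
    (Pi.single j 1 : Fin p → ℝ) ∈ sparseBall p k := by
  refine le_trans ?_ hk
  rw [← Finset.card_singleton j]
  refine Finset.card_le_card fun i hi => ?_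
  by_contra hij
  rw [Finset.mem_singleton] at hij
  simp [hij] at hi

lemma lqNorm_two_single {p : ℕ} (j : Fin p) : lqNorm 2 (Pi.single j 1 : Fin p → ℝ) = 1 := by
  rw [lqNorm]
  simp

lemma empNorm_col_le {n p : ℕ} (X : Matrix (Fin n) (Fin p) ℝ) {k : ℕ} (hk : 1 ≤ k) (j : Fin p) :
    empNorm (X.col j) ≤ sparseEigMax X k := by
  have h := empNorm_mulVec_le X (single_mem_sparseBall hk j) (by simp)
  rwa [lqNorm_two_single, mul_one, Matrix.mulVec_single_one] at h

lemma sparseEigMax_pos {n p k : ℕ} (hn : 1 ≤ n) (hk : 1 ≤ k) {X : Matrix (Fin n) (Fin p) ℝ}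
    (hX : X ≠ 0) : 0 < sparseEigMax X k := by
  obtain ⟨i, j, hij⟩ : ∃ i j, X i j ≠ 0 := by
    by_contra! h
    exact hX (Matrix.ext h)
  refine lt_of_lt_of_le ?_ (empNorm_col_le X hk j)
  rw [empNorm_eq]
  have hn' : (0 : ℝ) < n := by exact_mod_cast hn
  refine div_pos (norm_pos_iff.2 fun h => hij ?_) (Real.sqrt_pos.2 hn')
  exact congrFun ((WithLp.toLp_eq_zero 2).1 h) i

lemma sub_mem_sparseBall {p s : ℕ} {β γ : Fin p → ℝ} (hβ : β ∈ sparseBall p s)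
    (hγ : γ ∈ sparseBall p s) : β - γ ∈ sparseBall p (2 * s) := by
  classical
  have hsub : (Finset.univ.filter fun j => (β - γ) j ≠ 0) ⊆
      (Finset.univ.filter fun j => β j ≠ 0) ∪ (Finset.univ.filter fun j => γ j ≠ 0) := by
    intro j
    simp only [Finset.mem_filter, Finset.mem_univ, true_and, Finset.mem_union, Pi.sub_apply]
    contrapose!
    rintro ⟨h₁, h₂⟩
    rw [h₁, h₂, sub_zero]
  have h := (Finset.card_le_card hsub).trans (Finset.card_union_le _ _)
  have h₁ : (Finset.univ.filter fun j => β j ≠ 0).card ≤ s := hβ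
  have h₂ : (Finset.univ.filter fun j => γ j ≠ 0).card ≤ s := hγ
  change (Finset.univ.filter fun j => (β - γ) j ≠ 0).card ≤ 2 * s
  omega

/-! ### Sparse hypotheses indexed by words -/

/-- Signs can be chosen greedily so that the cross terms never increase the norm of a sum. -/
lemma exists_signs_norm_sq_sum_le {E ι : Type*} [NormedAddCommGroup E] [InnerProductSpace ℝ E]
    (w : ι → E) (S : Finset ι) :
    ∃ ε : ι → ℝ, (∀ k, |ε k| = 1) ∧ ‖∑ k ∈ S, ε k • w k‖ ^ 2 ≤ ∑ k ∈ S, ‖w k‖ ^ 2 := by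
  classical
  induction S using Finset.induction_on with
  | empty => exact ⟨fun _ => 1, by simp, by simp⟩
  | insert a S ha ih =>
    obtain ⟨ε, hε, hS⟩ := ih
    set u := ∑ k ∈ S, ε k • w k with hu
    obtain ⟨e, he, hneg⟩ : ∃ e : ℝ, |e| = 1 ∧ inner ℝ (e • w a) u ≤ 0 := by
      rcases le_total (inner ℝ (w a) u) 0 with h | h
      · exact ⟨1, by simp, by simpa using h⟩
      · exact ⟨-1, by simp, by simpa using h⟩
    refine ⟨Function.update ε a e, fun k => ?_, ?_⟩
    · by_cases hk : k = a
      · simpa [hk] using he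
      · simpa [hk] using hε k
    · have hsum : ∑ k ∈ S, Function.update ε a e k • w k = u := by
        refine Finset.sum_congr rfl fun k hk => ?_
        rw [Function.update_of_ne (ne_of_mem_of_not_mem hk ha)]
      rw [Finset.sum_insert ha, Finset.sum_insert ha, hsum, Function.update_self,
        norm_add_sq_real, norm_smul, Real.norm_eq_abs, he, one_mul]
      linarith

/-- The vector on `[p]` which has, in the `k`-th of `s` disjoint blocks of size `m`, the value
`v k` at the position given by the `k`-th letter of the word `f`, and zeros elsewhere. -/
noncomputable def blockVector {s m p : ℕ} (e : Fin s × Fin m ↪ Fin p) (f : Fin s → Fin m)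
    (v : Fin s → ℝ) : Fin p → ℝ :=
  ∑ k, Pi.single (e (k, f k)) (v k)

lemma blockVector_apply {s m p : ℕ} (e : Fin s × Fin m ↪ Fin p) (f : Fin s → Fin m)
    (v : Fin s → ℝ) (k : Fin s) (l : Fin m) :
    blockVector e f v (e (k, l)) = if l = f k then v k else 0 := by
  rw [blockVector, Finset.sum_apply, Finset.sum_eq_single k]
  · by_cases h : l = f k
    · simp [h]
    · simp [h]
  · intro k' _ hk'
    rw [Pi.single_apply, if_neg]
    simp [Ne.symm hk']
  · simp

lemma blockVector_mem_sparseBall {s m p : ℕ} (e : Fin s × Fin m ↪ Fin p) (f : Fin s → Fin m)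
    (v : Fin s → ℝ) : blockVector e f v ∈ sparseBall p s := by
  classical
  have hsub : (Finset.univ.filter fun j => blockVector e f v j ≠ 0) ⊆
      Finset.univ.image fun k => e (k, f k) := by
    intro j hj
    by_contra hj'
    simp only [Finset.mem_image, Finset.mem_univ, true_and, not_exists] at hj'
    refine (Finset.mem_filter.1 hj).2 ?_
    rw [blockVector, Finset.sum_apply]
    exact Finset.sum_eq_zero fun k _ => Pi.single_eq_of_ne (Ne.symm (hj' k)) _
  exact (Finset.card_le_card hsub).trans (Finset.card_image_le.trans (by simp))

lemma toLp_mulVec_blockVector {s m p n : ℕ} (X : Matrix (Fin n) (Fin p) ℝ)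
    (e : Fin s × Fin m ↪ Fin p) (f : Fin s → Fin m) (v : Fin s → ℝ) :
    (WithLp.toLp 2 (X *ᵥ blockVector e f v) : EuclideanSpace ℝ (Fin n)) =
      ∑ k, v k • WithLp.toLp 2 (X.col (e (k, f k))) := by
  rw [blockVector, Matrix.mulVec_sum, WithLp.toLp_sum]
  refine Finset.sum_congr rfl fun k _ => ?_
  rw [Matrix.mulVec_single, ← WithLp.toLp_smul]
  ext i
  simp [mul_comm]

/-- A family of `s`-sparse vectors indexed by the words in `[m]^s`. The supports of two of them
differ at least as much as the words, and suitable signs make the images under `X` as short as if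
the columns of `X` were orthogonal. -/
lemma exists_sparse_family {s m p n : ℕ} (hmp : s * m ≤ p) (X : Matrix (Fin n) (Fin p) ℝ)
    {θ : ℝ} (hθ : ∀ j, empNorm (X.col j) ≤ θ) (hn : 1 ≤ n) {r : ℝ} (hr : 0 ≤ r) :
    ∃ β : (Fin s → Fin m) → Fin p → ℝ, (∀ f, β f ∈ sparseBall p s) ∧
      (∀ f, ‖(WithLp.toLp 2 (X *ᵥ β f) : EuclideanSpace ℝ (Fin n))‖ ^ 2 ≤
        s * n * (r * θ) ^ 2) ∧
      ∀ f g, ∃ T : Finset (Fin p), hammingDist f g ≤ T.card ∧ ∀ j ∈ T, r ≤ |(β f - β g) j| := by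
  have e : Fin s × Fin m ↪ Fin p :=
    finProdFinEquiv.toEmbedding.trans (Fin.castLEEmb hmp)
  choose ε hε hsum using fun f : Fin s → Fin m =>
    exists_signs_norm_sq_sum_le
      (fun k => r • (WithLp.toLp 2 (X.col (e (k, f k))) : EuclideanSpace ℝ (Fin n))) Finset.univ
  have hn0 : (0 : ℝ) < n := by exact_mod_cast hn
  refine ⟨fun f => blockVector e f fun k => ε f k * r,
    fun f => blockVector_mem_sparseBall e f _, fun f => ?_, fun f g => ?_⟩
  · rw [toLp_mulVec_blockVector]
    simp_rw [mul_smul]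
    refine (hsum f).trans ?_
    have hcol : ∀ k, ‖r • (WithLp.toLp 2 (X.col (e (k, f k))) : EuclideanSpace ℝ (Fin n))‖ ^ 2 ≤
        n * (r * θ) ^ 2 := by
      intro k
      have h := hθ (e (k, f k))
      rw [empNorm_eq, div_le_iff₀ (Real.sqrt_pos.2 hn0)] at h
      rw [norm_smul, Real.norm_of_nonneg hr, mul_pow]
      calc r ^ 2 * ‖(WithLp.toLp 2 (X.col (e (k, f k))) : EuclideanSpace ℝ (Fin n))‖ ^ 2
          ≤ r ^ 2 * (θ * Real.sqrt n) ^ 2 := by gcongr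
        _ = n * (r * θ) ^ 2 := by
          rw [mul_pow θ, Real.sq_sqrt hn0.le]
          ring
    calc _ ≤ ∑ _k : Fin s, n * (r * θ) ^ 2 := Finset.sum_le_sum fun k _ => hcol k
      _ = s * n * (r * θ) ^ 2 := by simp [mul_assoc]
  · refine ⟨(Finset.univ.filter fun k => f k ≠ g k).map
      ⟨fun k => e (k, f k), fun k k' h => (Prod.ext_iff.1 (e.injective h)).1⟩, ?_, ?_⟩
    · rw [Finset.card_map]
      exact le_rfl
    · intro j hj
      obtain ⟨k, hk, rfl⟩ := Finset.mem_map.1 hj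
      have hne : f k ≠ g k := (Finset.mem_filter.1 hk).2
      change r ≤ |blockVector e f (fun k => ε f k * r) (e (k, f k)) -
        blockVector e g (fun k => ε g k * r) (e (k, f k))|
      simp [blockVector_apply, hne, abs_mul, hε, abs_of_nonneg hr]

/-! ### The minimax lower bounds -/

/-- The number `m = ⌊p/s⌋` of positions in a block is at least `2` and has
`e p / s < e (m + 1) ≤ m ^ 4`. -/
lemma log_exp_mul_div_le {p s : ℕ} (hs : 1 ≤ s) (hsp : 2 * s ≤ p) :
    Real.log (Real.exp 1 * p / s) ≤ 4 * Real.log (p / s : ℕ) := by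
  set m := p / s
  have hm : 2 ≤ m := (Nat.le_div_iff_mul_le hs).2 hsp
  have hm2 : (2 : ℝ) ≤ m := by exact_mod_cast hm
  have hs0 : (0 : ℝ) < s := by exact_mod_cast hs
  have hp0 : (0 : ℝ) < p := by exact_mod_cast (by omega : 0 < p)
  have hps : (p : ℝ) / s ≤ m + 1 := by
    rw [div_le_iff₀ hs0]
    have : p < s * (m + 1) := Nat.lt_mul_div_succ p hs
    have : (p : ℝ) < s * (m + 1) := by exact_mod_cast this
    linarith
  have hpow : ((m : ℝ)) ^ 4 ≥ 4 * ((m : ℝ) * m) := by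
    calc (m : ℝ) ^ 4 = (m * m) * (m * m) := by ring
      _ ≥ (2 * 2) * (m * m) := by gcongr
      _ = 4 * (m * m) := by norm_num
  rw [← Nat.cast_ofNat, ← Real.log_pow]
  refine Real.log_le_log (by positivity) ?_
  calc Real.exp 1 * p / s = Real.exp 1 * (p / s) := by ring
    _ ≤ 3 * (m + 1) := by
        gcongr
        linarith [Real.exp_one_lt_d9]
    _ ≤ (m : ℝ) ^ 4 := by nlinarith

lemma one_le_log_exp_mul_div {p s : ℕ} (hs : 1 ≤ s) (hsp : 2 * s ≤ p) :
    1 ≤ Real.log (Real.exp 1 * p / s) := by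
  have hs0 : (0 : ℝ) < s := by exact_mod_cast hs
  have hsp' : (s : ℝ) ≤ p := by exact_mod_cast (by omega : s ≤ p)
  have hp0 : (0 : ℝ) < p := hs0.trans_le hsp'
  rw [Real.le_log_iff_exp_le (by positivity), mul_div_assoc]
  exact le_mul_of_one_le_right (Real.exp_pos _).le ((one_le_div hs0).2 hsp')

lemma minimaxRate_pos {σ : ℝ} (hσ : 0 < σ) {n p s : ℕ} (hn : 1 ≤ n) (hs : 1 ≤ s)
    (hsp : 2 * s ≤ p) (q : ℝ≥0∞) : 0 < minimaxRate σ n p s q := by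
  have hn0 : (0 : ℝ) < n := by exact_mod_cast hn
  have hs0 : (0 : ℝ) < s := by exact_mod_cast hs
  have hlog := one_le_log_exp_mul_div hs hsp
  exact mul_pos (mul_pos hσ (Real.rpow_pos_of_pos hs0 _))
    (Real.sqrt_pos.2 (div_pos (zero_lt_one.trans_le hlog) hn0))

/-- If the loss `N` separates two `2s`-sparse differences by `2R` as soon as they differ by `r` in
more than `s / 8` coordinates, then every estimator has loss at least `R` with probability bounded
away from zero at some sparse vector. The amplitude `r` is chosen so that the likelihood ratios
against `β = 0` have second moment at most `m ^ (s / 16)`, where `m = ⌊p/s⌋`. -/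
lemma exists_obsLaw_real_ge {n p s : ℕ} {σ : ℝ} (hs : 1 ≤ s) (hsp : 2 * s ≤ p) (hn : 1 ≤ n)
    (hσ : 0 < σ) (X : Matrix (Fin n) (Fin p) ℝ) {θ : ℝ} (hθ0 : 0 < θ)
    (hθ : ∀ j, empNorm (X.col j) ≤ θ) {r : ℝ}
    (hr : r = σ * Real.sqrt (Real.log (Real.exp 1 * p / s) / n) / (8 * θ))
    {N : (Fin p → ℝ) → ℝ} (hNmeas : Measurable N) (hNsub : ∀ u v, N (u - v) ≤ N u + N v) {R : ℝ}
    (hR : ∀ δ ∈ sparseBall p (2 * s), ∀ T : Finset (Fin p), s < 8 * T.card →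
      (∀ j ∈ T, r ≤ |δ j|) → 2 * R ≤ N δ)
    {τ : EuclideanSpace ℝ (Fin n) → Fin p → ℝ} (hτ : Measurable τ) :
    ∃ β ∈ sparseBall p s,
      1 - (2 : ℝ) ^ (-(1 / 32) : ℝ) ≤ (obsLaw X σ β).real {y | R ≤ N (τ y - β)} := by
  have hn0 : (0 : ℝ) < n := by exact_mod_cast hn
  have hlog := one_le_log_exp_mul_div hs hsp
  have hm : 2 ≤ p / s := (Nat.le_div_iff_mul_le hs).2 hsp
  have hr0 : 0 ≤ r := by
    rw [hr]
    positivity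
  obtain ⟨β, hβ, hβX, hβsep⟩ :=
    exists_sparse_family (Nat.mul_div_le p s) X hθ hn hr0
  have hmeas : ∀ f, MeasurableSet {y | N (τ y - β f) < R} := fun f =>
    measurableSet_lt (hNmeas.comp (hτ.sub_const _)) measurable_const
  have hE : ∀ f, Real.exp (‖(WithLp.toLp 2 (X *ᵥ β f) : EuclideanSpace ℝ (Fin n))‖ ^ 2 / σ ^ 2) ≤
      ((p / s : ℕ) : ℝ) ^ (s / 16 : ℝ) := by
    intro f
    rw [Real.rpow_def_of_pos (by positivity), Real.exp_le_exp, div_le_iff₀ (by positivity)]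
    refine (hβX f).trans ?_
    -- The factor `1 / 64` turns `log (e p / s) ≤ 4 log m` into `(s / 16) log m`.
    have hrθ : (r * θ) ^ 2 = σ ^ 2 * (Real.log (Real.exp 1 * p / s) / n) / 64 := by
      have : r * θ = σ * Real.sqrt (Real.log (Real.exp 1 * p / s) / n) / 8 := by
        rw [hr]
        field_simp
      rw [this, div_pow, mul_pow, Real.sq_sqrt (by positivity)]
      norm_num
    rw [hrθ]
    calc (s : ℝ) * n * (σ ^ 2 * (Real.log (Real.exp 1 * p / s) / n) / 64)
        = s / 64 * Real.log (Real.exp 1 * p / s) * σ ^ 2 := by field_simp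
      _ ≤ s / 64 * (4 * Real.log (p / s : ℕ)) * σ ^ 2 := by
          gcongr
          exact log_exp_mul_div_le hs hsp
      _ = _ := by ring
  have hsep : ∀ y f g, y ∈ {y | N (τ y - β f) < R} → y ∈ {y | N (τ y - β g) < R} →
      8 * hammingDist f g ≤ s := by
    intro y f g hf hg
    by_contra! hlt
    obtain ⟨T, hT, hTr⟩ := hβsep g f
    rw [hammingDist_comm] at hT
    have h := hR _ (sub_mem_sparseBall (hβ g) (hβ f)) T (by omega) hTr
    have h' := hNsub (τ y - β f) (τ y - β g)
    rw [sub_sub_sub_cancel_left] at h'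
    have hf' : N (τ y - β f) < R := hf
    have hg' : N (τ y - β g) < R := hg
    linarith
  obtain ⟨f, hf⟩ := exists_measureReal_le_of_hamming hs hm (obsLaw X σ 0)
    (fun f => obsLaw X σ (β f)) le_rfl
    (fun f A hA t ht => (obsLaw_real_le X hσ (β f) hA ht).trans
      (by gcongr; exact hE f)) hmeas hsep
  refine ⟨β f, hβ f, ?_⟩
  have hcompl : {y | R ≤ N (τ y - β f)} = {y | N (τ y - β f) < R}ᶜ := by
    ext y
    simp
  rw [hcompl, probReal_compl_eq_one_sub (hmeas f)]
  linarith

/-- The factor `8 ^ (-1/q)` lost by having only `s / 8` large coordinates is bounded below by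
`1 / 8` uniformly in `q`, including `q = ∞`. -/
lemma mul_rpow_div_eight_le_lqNorm {p s : ℕ} (hs : 1 ≤ s) {q : ℝ≥0∞} (hq : 1 ≤ q)
    {v : Fin p → ℝ} {r : ℝ} (hr : 0 ≤ r) {T : Finset (Fin p)} (hT : s < 8 * T.card)
    (hv : ∀ j ∈ T, r ≤ |v j|) :
    r * (s : ℝ) ^ (1 / q).toReal / 8 ≤ lqNorm q v := by
  refine le_trans ?_
    (mul_card_rpow_le_lqNorm hq hr (Finset.card_pos.1 (by omega : 0 < T.card)) hv)
  have hx1 : (1 / q).toReal ≤ 1 := by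
    refine ENNReal.toReal_le_of_le_ofReal zero_le_one ?_
    simpa using hq
  have hsT : (s : ℝ) ≤ 8 * T.card := by exact_mod_cast hT.le
  rw [mul_div_assoc]
  gcongr
  rw [div_le_iff₀ (by norm_num)]
  calc (s : ℝ) ^ (1 / q).toReal ≤ (8 * T.card) ^ (1 / q).toReal := by gcongr
    _ = 8 ^ (1 / q).toReal * (T.card : ℝ) ^ (1 / q).toReal :=
        Real.mul_rpow (by norm_num) (by positivity)
    _ ≤ 8 ^ (1 : ℝ) * (T.card : ℝ) ^ (1 / q).toReal := by
        gcongr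
        norm_num
    _ = _ := by rw [Real.rpow_one, mul_comm]

/-- Markov's inequality for the loss: `ℓ` is at least `ℓ u` wherever its argument is at
least `u`. -/
lemma ofReal_mul_le_lintegral_loss {Ω : Type*} [MeasurableSpace Ω] {P : Measure Ω}
    [IsProbabilityMeasure P] {ℓ : ℝ≥0 → ℝ≥0} (hmono : Monotone ℓ) {u : ℝ≥0} {N : Ω → ℝ}
    (hN : Measurable N) {R a c : ℝ} (ha : 0 ≤ a) (haR : u ≤ a * R)
    (hc : c ≤ P.real {y | R ≤ N y}) :
    ENNReal.ofReal (ℓ u * c) ≤ ∫⁻ y, (ℓ (a * N y).toNNReal : ℝ≥0∞) ∂P := by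
  have hmeas : MeasurableSet {y | R ≤ N y} := measurableSet_le measurable_const hN
  calc ENNReal.ofReal (ℓ u * c) ≤ ENNReal.ofReal (ℓ u * P.real {y | R ≤ N y}) := by gcongr
    _ = ℓ u * P {y | R ≤ N y} := by
        rw [ENNReal.ofReal_mul (by positivity), ENNReal.ofReal_coe_nnreal, ofReal_measureReal]
    _ = ∫⁻ y, {y | R ≤ N y}.indicator (fun _ => (ℓ u : ℝ≥0∞)) y ∂P := by
        rw [lintegral_indicator_const hmeas]
    _ ≤ _ := by
        refine lintegral_mono (Set.indicator_le' (fun y hy => ?_) fun _ _ => zero_le)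
        refine ENNReal.coe_le_coe.2 (hmono (NNReal.le_toNNReal_of_coe_le (haR.trans ?_)))
        exact mul_le_mul_of_nonneg_left hy ha

lemma estimationRisk_lower_bound {ℓ : ℝ≥0 → ℝ≥0} (hmono : Monotone ℓ) (u : ℝ≥0) {q : ℝ≥0∞}
    (hq : 1 ≤ q) {p s n : ℕ} {σ : ℝ} (hs : 1 ≤ s) (hsp : 2 * s ≤ p) (hn : 1 ≤ n) (hσ : 0 < σ)
    (τ : Estimator n p) {X : Matrix (Fin n) (Fin p) ℝ} (hX : X ≠ 0) :
    ∃ β ∈ sparseBall p s, ENNReal.ofReal (ℓ u * (1 - (2 : ℝ) ^ (-(1 / 32) : ℝ))) ≤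
      estimationRisk ℓ (128 * u) σ s q τ X β := by
  set θ := sparseEigMax X 1 with hθdef
  have hθ : 0 < θ := sparseEigMax_pos hn le_rfl hX
  set ψ := minimaxRate σ n p s q with hψdef
  have hψ : 0 < ψ := minimaxRate_pos hσ hn hs hsp q
  have hlog := one_le_log_exp_mul_div hs hsp
  have hsep : ∀ δ ∈ sparseBall p (2 * s), ∀ T : Finset (Fin p), s < 8 * T.card →
      (∀ j ∈ T, σ * Real.sqrt (Real.log (Real.exp 1 * p / s) / n) / (8 * θ) ≤ |δ j|) →
      2 * (ψ / (128 * θ)) ≤ lqNorm q δ := by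
    intro δ _ T hT hδ
    refine le_trans (le_of_eq ?_) (mul_rpow_div_eight_le_lqNorm hs hq (by positivity) hT hδ)
    rw [hψdef, minimaxRate]
    field_simp
    norm_num
  obtain ⟨β, hβ, h⟩ := exists_obsLaw_real_ge hs hsp hn hσ X hθ
    (fun j => empNorm_col_le X le_rfl j) rfl (measurable_lqNorm hq) (lqNorm_sub_le hq)
    hsep (τ.2 X)
  refine ⟨β, hβ, ofReal_mul_le_lintegral_loss hmono
    ((measurable_lqNorm hq).comp ((τ.2 X).sub_const β)) (by positivity) ?_ h⟩
  rw [← hψdef, ← hθdef]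
  refine le_of_eq ?_
  field_simp

lemma predictionRisk_lower_bound {ℓ : ℝ≥0 → ℝ≥0} (hmono : Monotone ℓ) (u : ℝ≥0)
    {p s n : ℕ} {σ : ℝ} (hs : 1 ≤ s) (hsp : 2 * s ≤ p) (hn : 1 ≤ n) (hσ : 0 < σ)
    (τ : Estimator n p) (X : Matrix (Fin n) (Fin p) ℝ) :
    ∃ β ∈ sparseBall p s, ENNReal.ofReal (ℓ u * (1 - (2 : ℝ) ^ (-(1 / 32) : ℝ))) ≤
      predictionRisk ℓ (128 * u) σ s τ X β := by
  -- In the degenerate case the integrand is `∞` and any sparse vector serves.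
  by_cases hmin : sparseEigMin X (2 * s) = 0
  · exact ⟨0, by simp [sparseBall], by simp [predictionRisk, hmin]⟩
  simp only [predictionRisk, hmin, if_false]
  set κ := sparseEigMin X (2 * s) with hκdef
  have hκ : 0 < κ := lt_of_le_of_ne (sparseEigMin_nonneg X _) (Ne.symm hmin)
  set θ := sparseEigMax X (2 * s) with hθdef
  have hX : X ≠ 0 := by
    rintro rfl
    have h := sparseEigMin_mul_le (0 : Matrix (Fin n) (Fin p) ℝ)
      (single_mem_sparseBall (by omega : 1 ≤ 2 * s) ⟨0, by omega⟩) (by simp)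
    rw [lqNorm_two_single, mul_one] at h
    have h0 : empNorm (0 : Fin n → ℝ) = 0 := by simp [empNorm]
    rw [Matrix.zero_mulVec, h0] at h
    linarith
  have hθ : 0 < θ := sparseEigMax_pos hn (by omega) hX
  set ψ := minimaxRate σ n p s 2 with hψdef
  have hψ : 0 < ψ := minimaxRate_pos hσ hn hs hsp 2
  have hlog := one_le_log_exp_mul_div hs hsp
  have hmeas : Measurable fun δ : Fin p → ℝ => empNorm (X *ᵥ δ) := by
    unfold empNorm Matrix.mulVec dotProduct
    fun_prop
  have hsub : ∀ v w : Fin p → ℝ,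
      empNorm (X *ᵥ (v - w)) ≤ empNorm (X *ᵥ v) + empNorm (X *ᵥ w) := by
    intro v w
    rw [Matrix.mulVec_sub]
    exact empNorm_sub_le _ _
  have hsep : ∀ δ ∈ sparseBall p (2 * s), ∀ T : Finset (Fin p), s < 8 * T.card →
      (∀ j ∈ T, σ * Real.sqrt (Real.log (Real.exp 1 * p / s) / n) / (8 * θ) ≤ |δ j|) →
      2 * (κ * ψ / (128 * θ)) ≤ empNorm (X *ᵥ δ) := by
    intro δ hδs T hT hδ
    have hl := mul_rpow_div_eight_le_lqNorm hs (q := 2) (by norm_num) (by positivity) hT hδ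
    have hδ0 : δ ≠ 0 := by
      rintro rfl
      obtain ⟨j, hj⟩ := Finset.card_pos.1 (by omega : 0 < T.card)
      have h := hδ j hj
      rw [Pi.zero_apply, abs_zero] at h
      have hn0 : (0 : ℝ) < n := by exact_mod_cast hn
      have hsqrt := Real.sqrt_pos.2 (div_pos (zero_lt_one.trans_le hlog) hn0)
      exact h.not_gt (by positivity)
    refine le_trans ?_ (sparseEigMin_mul_le X hδs hδ0)
    refine le_trans (le_of_eq ?_) (mul_le_mul_of_nonneg_left hl hκ.le)
    rw [← hκdef, hψdef, minimaxRate]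
    field_simp
    norm_num
  obtain ⟨β, hβ, h⟩ := exists_obsLaw_real_ge hs hsp hn hσ X hθ
    (fun j => empNorm_col_le X (by omega) j) rfl hmeas hsub hsep (τ.2 X)
  refine ⟨β, hβ, ofReal_mul_le_lintegral_loss hmono
    (hmeas.comp ((τ.2 X).sub_const β)) (by positivity) ?_ h⟩
  refine le_of_eq ?_
  field_simp

theorem mainTheorem8 (ℓ : ℝ≥0 → ℝ≥0) (hmono : Monotone ℓ) (hzero : ℓ 0 = 0)
    (hne : ∃ u, ℓ u ≠ 0) :
    (∀ q : ℝ≥0∞, 1 ≤ q → ∃ b c : ℝ, 0 < b ∧ 0 < c ∧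
      ∀ (p s n : ℕ) (σ : ℝ), 2 ≤ p → 1 ≤ s → 2 * s ≤ p → 1 ≤ n → 0 < σ →
        ENNReal.ofReal c ≤
          ⨅ τ : Estimator n p, ⨅ X : Matrix (Fin n) (Fin p) ℝ, ⨅ _ : X ≠ 0,
            ⨆ β ∈ sparseBall p s, estimationRisk ℓ b σ s q τ X β) ∧
    (∃ b c : ℝ, 0 < b ∧ 0 < c ∧
      ∀ (p s n : ℕ) (σ : ℝ), 2 ≤ p → 1 ≤ s → 2 * s ≤ p → 1 ≤ n → 0 < σ →
        ENNReal.ofReal c ≤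
          ⨅ τ : Estimator n p, ⨅ X : Matrix (Fin n) (Fin p) ℝ,
            ⨆ β ∈ sparseBall p s, predictionRisk ℓ b σ s τ X β) := by
  obtain ⟨u, hu⟩ := hne
  have hu0 : 0 < u := pos_iff_ne_zero.2 fun h => hu (h ▸ hzero)
  have hb : (0 : ℝ) < 128 * u := by positivity
  have hc : (0 : ℝ) < ℓ u * (1 - (2 : ℝ) ^ (-(1 / 32) : ℝ)) :=
    mul_pos (by positivity)
      (sub_pos.2 (Real.rpow_lt_one_of_one_lt_of_neg (by norm_num) (by norm_num)))
  refine ⟨fun q hq => ⟨_, _, hb, hc, fun p s n σ _ hs hsp hn hσ => ?_⟩,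
    ⟨_, _, hb, hc, fun p s n σ _ hs hsp hn hσ => ?_⟩⟩
  · refine le_iInf fun τ => le_iInf fun X => le_iInf fun hX => ?_
    obtain ⟨β, hβ, h⟩ := estimationRisk_lower_bound hmono u hq hs hsp hn hσ τ hX
    exact h.trans (le_iSup₂_of_le β hβ le_rfl)
  · refine le_iInf fun τ => le_iInf fun X => ?_
    obtain ⟨β, hβ, h⟩ := predictionRisk_lower_bound hmono u hs hsp hn hσ τ X
    exact h.trans (le_iSup₂_of_le β hβ le_rfl)
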